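/- Call a group $G$ an $E$-group if every element commutes with all of its endomorphic images, i.e. $g\,f(g)=f(g)\,g$ for all $g\in G$ and all $f\in \mathrm{End}(G)$. For a prime $p$, a $pE$-group is a $p$-group that is an $E$-group. A group is $3$-generator if it is generated by three (not necessarily distinct) elements. An automorphism $\alpha$ of $G$ is central if $g^{-1}\alpha(g)\in Z(G)$ for all $g\in G$. Lemma. Let $p$ be a prime, let $G$ be a finite $3$-generator $pE$-group and let $\alpha\in \mathrm{End}(G)$. (i) If $\alpha\in \mathrm{Aut}(G)$, then $\alpha$ is a central automorphism. (ii) If $\alpha\notin \mathrm{Aut}(G)$, then $\mathrm{Im}\,\alpha\leq Z(G)$. -/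

import Mathlib

/-- An E-group: every element commutes with all of its endomorphic images. -/
def IsEGroup (G : Type*) [Group G] : Prop :=
  ∀ (f : G →* G) (g : G), Commute g (f g)

/-- A pE-group, for a prime `p`: a `p`-group that is an E-group. -/
structure IsPEGroup (p : ℕ) (G : Type*) [Group G] : Prop where
  prime : p.Prime
  isPGroup : IsPGroup p G
  isEGroup : IsEGroup G

/-- A 3-generator group: one generated by three (not necessarily distinct) elements. -/
def IsThreeGenerator (G : Type*) [Group G] : Prop :=
  ∃ a b c : G, Subgroup.closure {a, b, c} = ⊤

/-- An endomorphism that is an automorphism of the group. -/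
def IsAutomorphism {G : Type*} [Group G] (α : G →* G) : Prop :=
  Function.Bijective α

/-- A central automorphism: an automorphism that moves every element only by a central factor. -/
structure IsCentralAutomorphism {G : Type*} [Group G] (α : G →* G) : Prop where
  isAutomorphism : IsAutomorphism α
  inv_mul_mem_center : ∀ g : G, g⁻¹ * α g ∈ Subgroup.center G

open Subgroup
open scoped commutatorElement IsMulCommutative

/-! ### Elements killed by the exponent of the abelianization -/

section Omega

/-! Let n be the exponent of G/G'. If g ^ n = 1, some homomorphism maps G/G' onto ⟨g⟩, so g is the
value of an endomorphism of G with image ⟨g⟩; the E-property then makes g central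
(`IsEGroup.mem_center_of_pow_eq_one`). This is the main source of central elements below.

Inner automorphisms show that G is 2-Engel, so by Levi's argument its class is at most three and its
triple commutators have exponent dividing 3. This gives class two for p ≠ 3. For p = 3, three
generators turn [x,y] ^ n into an alternating form of odd rank with cyclic values; its degeneracy
together with the centrality criterion again gives class two (`IsPEGroup.commutator_mem_center`).

In class two the commutator is a biadditive alternating form for which every endomorphism f
satisfies [f x, y] = [x, f y]. For nonabelian G, let p ^ (s+1) be the exponent of G'. The p ^ s-th
powers of commutators do not form a cyclic group, so some generating triple has commutators
independent enough to force [f x, y] = l[x, y] for one integer l. Comparing n-th powers gives l² ≡ l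
modulo p ^ (s+1), hence l ≡ 0 or 1: either f has central image, or f moves elements by central
factors. In the second case Z(G) ≤ G^p G' makes f surjective, which separates automorphisms from the
rest. Abelian G is trivial. -/

theorem exists_hom_of_pow_exponent_eq_one {A G : Type*} [CommGroup A] [Finite A] [Group G]
    {g : G} (hg : g ^ Monoid.exponent A = 1) :
    ∃ f : A →* G, g ∈ f.range ∧ f.range ≤ zpowers g := by
  have : NeZero (Monoid.exponent A) := ⟨Monoid.exponent_ne_zero_of_finite⟩
  -- A finite abelian group is isomorphic to its character group, so some character has order equal
  -- to the exponent; its image is cyclic of that order.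
  obtain ⟨e⟩ := CommGroup.monoidHom_mulEquiv_of_hasEnoughRootsOfUnity A ℂ
  have : Finite (A →* ℂˣ) := Finite.of_equiv A e.symm.toEquiv
  obtain ⟨χ, hχ⟩ := Monoid.exists_orderOf_eq_exponent
    (Monoid.ExponentExists.of_finite (G := A →* ℂˣ))
  rw [Monoid.exponent_eq_of_mulEquiv e] at hχ
  have : Finite χ.range := Set.finite_range χ
  obtain ⟨t, ht⟩ := IsCyclic.exists_generator (α := χ.range)
  have hdvd : orderOf g ∣ orderOf t := by
    refine (orderOf_dvd_of_pow_eq_one hg).trans ?_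
    rw [← hχ]
    refine orderOf_dvd_of_pow_eq_one ?_
    ext x
    obtain ⟨k, hk⟩ := mem_zpowers_iff.1 (ht (χ.rangeRestrict x))
    have : (χ.rangeRestrict x) ^ orderOf t = 1 := by
      rw [← hk, ← zpow_natCast, ← zpow_mul, mul_comm, zpow_mul, zpow_natCast, pow_orderOf_eq_one,
        one_zpow]
    simpa using congrArg (fun y : χ.range => ((y : ℂˣ) : ℂ)) this
  refine ⟨(monoidHomOfForallMemZpowers ht hdvd).comp χ.rangeRestrict, ?_, ?_⟩
  · obtain ⟨x, hx⟩ := χ.rangeRestrict_surjective t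
    exact ⟨x, by simp [hx]⟩
  · rintro _ ⟨x, rfl⟩
    obtain ⟨k, hk⟩ := mem_zpowers_iff.1 (ht (χ.rangeRestrict x))
    refine mem_zpowers_iff.2 ⟨k, ?_⟩
    rw [MonoidHom.comp_apply, ← hk, map_zpow, monoidHomOfForallMemZpowers_apply_gen]

/-- In an E-group every element whose order divides the exponent of the abelianization is
central. -/
theorem IsEGroup.mem_center_of_pow_eq_one {G : Type*} [Group G] [Finite G] (hE : IsEGroup G)
    {g : G} (hg : g ^ Monoid.exponent (Abelianization G) = 1) : g ∈ center G := by
  obtain ⟨f, ⟨q, hq⟩, hf⟩ := exists_hom_of_pow_exponent_eq_one hg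
  obtain ⟨x, rfl⟩ := QuotientGroup.mk_surjective q
  set φ : G →* G := f.comp Abelianization.of with hφ
  have hx : φ x = g := hq
  have key : ∀ y, φ y = g → Commute y g := fun y hy => by simpa [hy] using hE φ y
  rw [mem_center_iff]
  intro y
  obtain ⟨k, hk⟩ := mem_zpowers_iff.1 (hf ⟨Abelianization.of y, rfl⟩)
  -- The factor x ^ (1 - k) moves y into the fibre of φ over g, whose elements commute with g; x
  -- lies in that fibre too.
  have h1 : φ (x ^ (1 - k) * y) = g := by
    have : φ y = g ^ k := hk.symm
    rw [map_mul, map_zpow, hx, this, ← zpow_add]; simp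
  have h2 := key _ h1
  have h3 : Commute (x ^ (1 - k)) g := (key x hx).zpow_left _
  have := (h3.inv_left).mul_left h2
  simpa using this.eq

theorem pow_exponent_mem_commutator {G : Type*} [Group G] (x : G) :
    x ^ Monoid.exponent (Abelianization G) ∈ commutator G := by
  rw [← Abelianization.ker_of G, MonoidHom.mem_ker, map_pow, Monoid.pow_exponent_eq_one]

theorem exponent_eq_prime_pow {p : ℕ} (hp : p.Prime) {G : Type*} [Group G] [Finite G]
    (h : IsPGroup p G) : ∃ m, Monoid.exponent (Abelianization G) = p ^ m := by
  have : Fact p.Prime := ⟨hp⟩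
  have : IsPGroup p (Abelianization G) := h.of_surjective _ (QuotientGroup.mk'_surjective _)
  obtain ⟨k, hk⟩ := IsPGroup.iff_card.1 this
  obtain ⟨m, -, hm⟩ := (Nat.dvd_prime_pow hp).1 (hk ▸ Group.exponent_dvd_nat_card)
  exact ⟨m, hm⟩

end Omega

/-! ### 2-Engel groups and Levi's theorem -/

section Engel

/-- Expand the third square. Multiplying by Y on the left and cancelling the unit Z + 1 kills YZY;
multiplying by Z then kills ZYZ, and YZ + ZY is left. It is used with Y, Z of the form (conjugation
− 1) on an abelian normal closure. -/
theorem anticomm_of_sq_eq_zero {R : Type*} [Ring R] {Y Z : R} (hY : Y * Y = 0) (hZ : Z * Z = 0)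
    {z' : R} (hz : (Z + 1) * z' = 1)
    (hYZ : ((Y + 1) * (Z + 1) - 1) * ((Y + 1) * (Z + 1) - 1) = 0) : Y * Z = - (Z * Y) := by
  have e1 : Y * Z * Y * Z + Y * Z * Y + Y * Z + Z * Y + Z * Y * Z = 0 := by
    have : ((Y + 1) * (Z + 1) - 1) * ((Y + 1) * (Z + 1) - 1)
      = Y * Z * Y * Z + Y * Z * Y + Y * Z + Z * Y + Z * Y * Z
        + Y * (Z * Z) + (Y * Y) * Z + Y * Y + Z * Z := by noncomm_ring
    rw [hY, hZ] at this
    simpa [hYZ] using this.symm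
  have e2 : Y * Z * Y * (Z + 1) = 0 := by
    have := congrArg (Y * ·) e1
    simp only [mul_add, mul_zero, ← mul_assoc, hY, zero_mul, zero_add] at this
    rw [mul_add, mul_one, add_comm]; exact this
  have e3 : Y * Z * Y = 0 := by
    have := congrArg (· * z') e2
    simpa [mul_assoc, hz] using this
  have e4 : Y * Z + Z * Y + Z * Y * Z = 0 := by simpa [e3] using e1
  have e5 : Z * Y * Z = 0 := by
    have := congrArg (Z * ·) e4
    simpa only [mul_add, mul_zero, ← mul_assoc, hZ, zero_mul, add_zero] using this
  rw [e5, add_zero] at e4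
  exact eq_neg_of_add_eq_zero_left e4

theorem one_add_mul_one_sub {R : Type*} [Ring R] {Y : R} (hY : Y * Y = 0) :
    (Y + 1) * (1 - Y) = 1 := by
  calc (Y + 1) * (1 - Y) = 1 - Y * Y := by noncomm_ring
    _ = 1 := by rw [hY, sub_zero]

theorem commutator_sub_one_of_anticomm {R : Type*} [Ring R] {Y Z : R} (hY : Y * Y = 0)
    (hZ : Z * Z = 0) (hYZ : Y * Z = - (Z * Y)) :
    (Y + 1) * (Z + 1) * (1 - Y) * (1 - Z) - 1 = Y * Z + Y * Z := by
  have : (Y + 1) * (Z + 1) * (1 - Y) * (1 - Z) - 1 = Y * (Z * Y) * Z - (Y * Z) * Y + Y * Z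
      - Z * Y + (Z * Y) * Z - Y * (Z * Z) - Y * Y - Z * Z + (Y * Y) * Z := by noncomm_ring
  rw [this, hZ, hY, show Z * Y = - (Y * Z) by rw [hYZ, neg_neg]]
  have h3 : Y * -(Y * Z) = 0 := by rw [mul_neg, ← mul_assoc, hY, zero_mul, neg_zero]
  have h4 : Y * Z * Y = 0 := by rw [hYZ, neg_mul, mul_assoc, hY, mul_zero, neg_zero]
  have h5 : -(Y * Z) * Z = 0 := by rw [neg_mul, mul_assoc, hZ, mul_zero, neg_zero]
  rw [h3, h4, h5]; simp

variable {G : Type*} [Group G]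

/-- The action by conjugation on an abelian normal subgroup, written additively. -/
def conjEnd (A : Subgroup G) [A.Normal] [IsMulCommutative A] : G →* AddMonoid.End (Additive A) where
  toFun y := MonoidHom.toAdditive (MulAut.conjNormal y : MulAut A).toMonoidHom
  map_one' := by rw [map_one]; rfl
  map_mul' x y := by rw [map_mul]; rfl

theorem conjEnd_sub_one_apply (A : Subgroup G) [A.Normal] [IsMulCommutative A] (y : G)
    (a : Additive A) :
    (((conjEnd A y - 1) a).toMul : G) = ⁅y, (a.toMul : G)⁆ := by
  change (((MulAut.conjNormal y a.toMul : A) / a.toMul : A) : G) = _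
  rw [div_eq_mul_inv]
  simp [commutatorElement_def]

/-- Every element commutes with its conjugates, that is, the group is 2-Engel. -/
def IsTwoEngel (G : Type*) [Group G] : Prop := ∀ x g : G, Commute x (g * x * g⁻¹)

theorem IsEGroup.isTwoEngel (h : IsEGroup G) : IsTwoEngel G := fun x g => by
  simpa using h (MulAut.conj g).toMonoidHom x

namespace IsTwoEngel

variable (h : IsTwoEngel G)
include h

theorem commute_commutator_right (x y : G) : Commute y ⁅x, y⁆ := by
  rw [commutatorElement_def]
  exact (h y x).mul_right (Commute.refl y).inv_right

theorem commute_commutator_left (x y : G) : Commute x ⁅x, y⁆ := by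
  rw [← commutatorElement_inv]
  exact (h.commute_commutator_right y x).inv_right

theorem commutator_inv_right (x y : G) : ⁅x, y⁻¹⁆ = ⁅x, y⁆⁻¹ := by
  have := (h y x).inv_right.eq
  rw [commutatorElement_inv]
  simp only [commutatorElement_def, inv_inv]
  simp only [mul_inv_rev, inv_inv] at this
  simpa [mul_assoc] using this.symm

theorem isMulCommutative_normalClosure (x : G) : IsMulCommutative (normalClosure {x}) := by
  refine Subgroup.isMulCommutative_closure ?_
  intro a ha b hb
  simp only [Group.mem_conjugatesOfSet_iff, Set.mem_singleton_iff, exists_eq_left,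
    isConj_iff] at ha hb
  obtain ⟨u, rfl⟩ := ha
  obtain ⟨v, rfl⟩ := hb
  have := h x (u⁻¹ * v)
  have := this.map (MulAut.conj u).toMonoidHom
  simpa [mul_assoc] using this.eq

theorem conjEnd_sub_one_mul_self (x : G) [IsMulCommutative (normalClosure {x})] (y : G) :
    (conjEnd (normalClosure {x}) y - 1) * (conjEnd (normalClosure {x}) y - 1) = 0 := by
  ext a
  have : (((conjEnd (normalClosure {x}) y - 1)
      ((conjEnd (normalClosure {x}) y - 1) (Additive.ofMul a))).toMul : G) = 1 := by
    rw [conjEnd_sub_one_apply, conjEnd_sub_one_apply]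
    exact commutatorElement_eq_one_iff_commute.2 (h.commute_commutator_left _ _)
  exact this

theorem conjEnd_anticomm (x : G) [IsMulCommutative (normalClosure {x})] (y z : G) :
    (conjEnd (normalClosure {x}) y - 1) * (conjEnd (normalClosure {x}) z - 1) =
    - ((conjEnd (normalClosure {x}) z - 1) * (conjEnd (normalClosure {x}) y - 1)) := by
  refine anticomm_of_sq_eq_zero (h.conjEnd_sub_one_mul_self x y) (h.conjEnd_sub_one_mul_self x z)
    (z' := conjEnd (normalClosure {x}) z⁻¹) ?_ ?_
  · rw [sub_add_cancel, ← map_mul, mul_inv_cancel, map_one]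
  · rw [sub_add_cancel, sub_add_cancel, ← map_mul]
    exact h.conjEnd_sub_one_mul_self x (y * z)

theorem commutator_swap_left (y z x : G) : ⁅y, ⁅z, x⁆⁆ = ⁅z, ⁅y, x⁆⁆⁻¹ := by
  have := h.isMulCommutative_normalClosure x
  set A := normalClosure {x}
  let a : Additive A := Additive.ofMul ⟨x, subset_normalClosure rfl⟩
  have h1 : (conjEnd A y - 1) ((conjEnd A z - 1) a) = -((conjEnd A z - 1) ((conjEnd A y - 1) a)) :=
    DFunLike.congr_fun (h.conjEnd_anticomm x y z) a
  have h2 := congrArg (fun a : Additive A => (a.toMul : G)) h1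
  simp only [toMul_neg, InvMemClass.coe_inv, conjEnd_sub_one_apply] at h2
  exact h2

theorem commutator_swap_right (x y z : G) : ⁅x, ⁅y, z⁆⁆ = ⁅x, ⁅z, y⁆⁆⁻¹ := by
  rw [← h.commutator_inv_right, commutatorElement_inv]

theorem commutator_rotate (x y z : G) : ⁅x, ⁅y, z⁆⁆ = ⁅y, ⁅z, x⁆⁆ := by
  rw [h.commutator_swap_left, h.commutator_swap_right y x z, inv_inv]

/-- On the normal closure of x, conjugation by y is 1 + Y with inverse 1 - Y, and anticommutation
reduces the operator of ⁅y, z⁆ minus 1 to 2YZ. -/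
theorem commutator_commutator_left (y z x : G) : ⁅⁅y, z⁆, x⁆ = ⁅y, ⁅z, x⁆⁆ ^ 2 := by
  have := h.isMulCommutative_normalClosure x
  set A := normalClosure {x}
  set Y := conjEnd A y - 1 with hY
  set Z := conjEnd A z - 1 with hZ
  have hYZ : Y * Z = - (Z * Y) := h.conjEnd_anticomm x y z
  have hYY : Y * Y = 0 := h.conjEnd_sub_one_mul_self x y
  have hZZ : Z * Z = 0 := h.conjEnd_sub_one_mul_self x z
  have inv : ∀ w : G, conjEnd A w⁻¹ = 1 - (conjEnd A w - 1) := fun w => by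
    have h1 := one_add_mul_one_sub (h.conjEnd_sub_one_mul_self x w)
    rw [sub_add_cancel] at h1
    have h2 : conjEnd A w⁻¹ * conjEnd A w = 1 := by rw [← map_mul, inv_mul_cancel, map_one]
    exact left_inv_eq_right_inv h2 h1
  have e : conjEnd A ⁅y, z⁆ - 1 = Y * Z + Y * Z := by
    rw [commutatorElement_def, map_mul, map_mul, map_mul, inv, inv, ← hY, ← hZ,
      ← commutator_sub_one_of_anticomm hYY hZZ hYZ, hY, hZ, sub_add_cancel, sub_add_cancel]
  let a : Additive A := Additive.ofMul ⟨x, subset_normalClosure rfl⟩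
  have h1 : (conjEnd A ⁅y, z⁆ - 1) a = Y (Z a) + Y (Z a) := DFunLike.congr_fun e a
  have h2 := congrArg (fun a : Additive A => (a.toMul : G)) h1
  simp only [toMul_add, Subgroup.coe_mul, conjEnd_sub_one_apply, hY, hZ] at h2
  rw [sq]
  exact h2

/-- ⁅⁅x, y⁆, z⁆ is the square of ⁅x, ⁅y, z⁆⁆ by the previous identity, and its inverse by cyclic
symmetry. -/
theorem triple_commutator_pow_three (x y z : G) : ⁅x, ⁅y, z⁆⁆ ^ 3 = 1 := by
  have h1 := h.commutator_commutator_left x y z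
  rw [← commutatorElement_inv, h.commutator_rotate] at h1
  rw [pow_succ, ← h1, inv_mul_cancel]

/-- Levi: 2-Engel groups have class at most three. -/
theorem quadruple_commutator (t z x y : G) : ⁅t, ⁅z, ⁅x, y⁆⁆⁆ = 1 := by
  have h3 := h.triple_commutator_pow_three t z ⁅x, y⁆
  have h1 := h.commutator_commutator_left t z ⁅x, y⁆
  have h2 := h.commutator_commutator_left x y ⁅t, z⁆
  -- With q the fourfold commutator, both ⁅⁅t, z⁆, ⁅x, y⁆⁆ and its inverse equal q ^ 2; so q ^ 4 =
  -- 1, while q ^ 3 = 1.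
  have e : ⁅x, ⁅y, ⁅t, z⁆⁆⁆ = ⁅t, ⁅z, ⁅x, y⁆⁆⁆ := by
    rw [h.commutator_rotate y t z, h.commutator_swap_left x t,
      h.commutator_swap_left x z y, h.commutator_inv_right, inv_inv]
  rw [e, ← commutatorElement_inv, h1] at h2
  have h4 : ⁅t, ⁅z, ⁅x, y⁆⁆⁆ ^ 4 = 1 := by
    rw [show 4 = 2 + 2 from rfl, pow_add]
    nth_rewrite 1 [← h2]
    rw [inv_mul_cancel]
  rwa [pow_succ, h3, one_mul] at h4

theorem triple_commutator_mem_center (x y z : G) : ⁅x, ⁅y, z⁆⁆ ∈ center G := by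
  rw [mem_center_iff]
  intro g
  exact (commutatorElement_eq_one_iff_commute.1 (h.quadruple_commutator g x y z)).eq

theorem triple_commutator_mul_left (x x' y z : G) :
    ⁅x * x', ⁅y, z⁆⁆ = ⁅x, ⁅y, z⁆⁆ * ⁅x', ⁅y, z⁆⁆ := by
  rw [commutatorElement_mul_left_eq_conj_mul,
    mem_center_iff.1 (h.triple_commutator_mem_center x' y z) x, mul_inv_cancel_right,
    mem_center_iff.1 (h.triple_commutator_mem_center x' y z)]

end IsTwoEngel

end Engel

/-! ### Three generators force class two -/

section ClassTwo

variable {G : Type*} [Group G]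

theorem forall_mem_of_closure_triple {a b c : G} (hgen : closure {a, b, c} = ⊤) {K : Subgroup G}
    (ha : a ∈ K) (hb : b ∈ K) (hc : c ∈ K) (x : G) : x ∈ K := by
  have : closure {a, b, c} ≤ K := by
    rw [closure_le]
    rintro y (rfl | rfl | rfl) <;> assumption
  exact this (hgen ▸ mem_top x)

theorem map_zpow_mul_zpow_mul_zpow {H : Type*} [Group H] (φ : G →* H) (a b c : G) (i j k : ℤ) :
    φ (a ^ i * b ^ j * c ^ k) = φ a ^ i * φ b ^ j * φ c ^ k := by
  simp only [map_mul, map_zpow]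

namespace IsTwoEngel

variable (h : IsTwoEngel G)

/-- The commutator `⁅x, ⁅y, z⁆⁆` of a 2-Engel group as a homomorphism in `x`. -/
def tripleHom (y z : G) : G →* G where
  toFun x := ⁅x, ⁅y, z⁆⁆
  map_one' := commutatorElement_one_left _
  map_mul' x x' := h.triple_commutator_mul_left x x' y z

theorem mem_comap_tripleHom {x y z : G} {K : Subgroup G} :
    x ∈ K.comap (h.tripleHom y z) ↔ ⁅x, ⁅y, z⁆⁆ ∈ K := Iff.rfl

include h

theorem triple_self_left (x y : G) : ⁅x, ⁅x, y⁆⁆ = 1 :=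
  commutatorElement_eq_one_iff_commute.2 (h.commute_commutator_left x y)

theorem triple_self_right (x y : G) : ⁅y, ⁅x, y⁆⁆ = 1 :=
  commutatorElement_eq_one_iff_commute.2 (h.commute_commutator_right x y)

/-- The triple commutator is trilinear and alternating, so on three generators it is determined by
its single value at (a, b, c). -/
theorem triple_mem_zpowers {a b c : G} (hgen : closure {a, b, c} = ⊤) (x y z : G) :
    ⁅x, ⁅y, z⁆⁆ ∈ zpowers ⁅a, ⁅b, c⁆⁆ := by
  set K := zpowers ⁅a, ⁅b, c⁆⁆
  have hT : ⁅a, ⁅b, c⁆⁆ ∈ K := mem_zpowers _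
  have h1 : ∀ x, ⁅x, ⁅b, c⁆⁆ ∈ K :=
    forall_mem_of_closure_triple hgen (K := K.comap (h.tripleHom b c)) hT
      (by simp [tripleHom, h.triple_self_left]) (by simp [tripleHom, h.triple_self_right])
  have h2 : ∀ x, ⁅x, ⁅c, a⁆⁆ ∈ K :=
    forall_mem_of_closure_triple hgen (K := K.comap (h.tripleHom c a))
      (by simp [tripleHom, h.triple_self_right])
      (by simpa [tripleHom, ← h.commutator_rotate a b c] using hT)
      (by simp [tripleHom, h.triple_self_left])
  have h3 : ∀ x, ⁅x, ⁅a, b⁆⁆ ∈ K :=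
    forall_mem_of_closure_triple hgen (K := K.comap (h.tripleHom a b))
      (by simp [tripleHom, h.triple_self_left])
      (by simp [tripleHom, h.triple_self_right])
      (by simpa [tripleHom, h.commutator_rotate c a b] using hT)
  have swap : ∀ x y z, ⁅x, ⁅y, z⁆⁆ ∈ K → ⁅x, ⁅z, y⁆⁆ ∈ K := fun x y z hxyz => by
    rw [h.commutator_swap_right]; exact K.inv_mem hxyz
  have hc : ∀ x z, ⁅x, ⁅z, c⁆⁆ ∈ K := fun x z => by
    rw [h.commutator_rotate]
    refine forall_mem_of_closure_triple hgen (K := K.comap (h.tripleHom c x)) ?_ ?_ ?_ z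
    all_goals rw [mem_comap_tripleHom]
    · rw [← h.commutator_rotate]; exact swap _ _ _ (h2 x)
    · rw [← h.commutator_rotate]; exact h1 x
    · simp [h.triple_self_left]
  have hb : ∀ x z, ⁅x, ⁅z, b⁆⁆ ∈ K := fun x z => by
    rw [h.commutator_rotate]
    refine forall_mem_of_closure_triple hgen (K := K.comap (h.tripleHom b x)) ?_ ?_ ?_ z
    all_goals rw [mem_comap_tripleHom]
    · rw [← h.commutator_rotate]; exact h3 x
    · simp [h.triple_self_left]
    · rw [← h.commutator_rotate]; exact swap _ _ _ (h1 x)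
  have ha : ∀ x z, ⁅x, ⁅z, a⁆⁆ ∈ K := fun x z => by
    rw [h.commutator_rotate]
    refine forall_mem_of_closure_triple hgen (K := K.comap (h.tripleHom a x)) ?_ ?_ ?_ z
    all_goals rw [mem_comap_tripleHom]
    · simp [h.triple_self_left]
    · rw [← h.commutator_rotate]; exact swap _ _ _ (h3 x)
    · rw [← h.commutator_rotate]; exact h2 x
  rw [← h.commutator_rotate]
  refine forall_mem_of_closure_triple hgen (K := K.comap (h.tripleHom x y)) ?_ ?_ ?_ z
  all_goals rw [mem_comap_tripleHom, h.commutator_rotate]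
  exacts [ha x y, hb x y, hc x y]

theorem commutator_pow_left (x y : G) (n : ℕ) : ⁅x ^ n, y⁆ = ⁅x, y⁆ ^ n := by
  induction n with
  | zero => simp
  | succ n ih =>
    rw [pow_succ', commutatorElement_mul_left_eq_conj_mul, ih, pow_succ,
      ((h.commute_commutator_left x y).pow_right n).eq, mul_inv_cancel_right]

theorem commute_commutators (x y z t : G) : Commute ⁅x, y⁆ ⁅z, t⁆ := by
  rw [← commutatorElement_eq_one_iff_commute, h.commutator_commutator_left,
    h.quadruple_commutator, one_pow]

/-- The defect of additivity is a central triple commutator, whose cube is trivial. -/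
theorem commutator_mul_left_pow {n : ℕ} (hn : 3 ∣ n) (x x' y : G) :
    ⁅x * x', y⁆ ^ n = ⁅x, y⁆ ^ n * ⁅x', y⁆ ^ n := by
  obtain ⟨k, rfl⟩ := hn
  have e : ⁅x * x', y⁆ = ⁅x, ⁅x', y⁆⁆ * (⁅x, y⁆ * ⁅x', y⁆) := by
    rw [commutatorElement_mul_left_eq_conj_mul, (h.commute_commutators x y x' y).eq,
      commutatorElement_def x ⁅x', y⁆]
    group
  have hz : Commute ⁅x, ⁅x', y⁆⁆ (⁅x, y⁆ * ⁅x', y⁆) :=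
    ((mem_center_iff.1 (h.triple_commutator_mem_center x x' y)) _).symm
  rw [e, hz.mul_pow, (h.commute_commutators x y x' y).mul_pow, pow_mul ⁅x, ⁅x', y⁆⁆,
    h.triple_commutator_pow_three, one_pow, one_mul]

omit h in
/-- The power `⁅x, y⁆ ^ n` of a commutator in a 2-Engel group, for `3 ∣ n`, as a homomorphism
in `x`. -/
def commutatorPowHom (h : IsTwoEngel G) {n : ℕ} (hn : 3 ∣ n) (y : G) : G →* G where
  toFun x := ⁅x, y⁆ ^ n
  map_one' := by simp
  map_mul' x x' := h.commutator_mul_left_pow hn x x' y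

omit h in
theorem commutator_pow_swap (x y : G) (n : ℕ) : ⁅x, y⁆ ^ n = (⁅y, x⁆ ^ n)⁻¹ := by
  rw [← inv_pow, commutatorElement_inv]

/-- ⁅x, y⁆ ^ n = ⁅x ^ n, y⁆ with x ^ n in G', so it is a product of triple commutators and their
inverses. -/
theorem commutator_pow_exponent_mem_zpowers {a b c : G} (hgen : closure {a, b, c} = ⊤) (x y : G) :
    ⁅x, y⁆ ^ Monoid.exponent (Abelianization G) ∈ zpowers ⁅a, ⁅b, c⁆⁆ := by
  rw [← h.commutator_pow_left, ← inv_mem_iff, commutatorElement_inv]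
  have key : ∀ d ∈ commutator G, ⁅y, d⁆ ∈ zpowers ⁅a, ⁅b, c⁆⁆ := by
    intro d hd
    rw [commutator_eq_closure] at hd
    induction hd using closure_induction with
    | mem d hd =>
      obtain ⟨u, v, rfl⟩ := hd
      exact h.triple_mem_zpowers hgen y u v
    | one => simp
    | mul d d' _ _ hd hd' =>
      rw [commutatorElement_mul_right_eq_mul_conj]
      have hz : ⁅y, d'⁆ ∈ center G :=
        (zpowers_le.2 (h.triple_commutator_mem_center a b c)) hd'
      rw [mul_assoc ⁅y, d⁆, mem_center_iff.1 hz d, mul_assoc, mul_assoc, mul_inv_cancel, mul_one]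
      exact mul_mem hd hd'
    | inv d _ hd =>
      rw [h.commutator_inv_right]
      exact inv_mem hd
  exact key _ (pow_exponent_mem_commutator x)

end IsTwoEngel

/-- An alternating form on three generators with values in a cyclic group is degenerate. With values
k, j, l at (a, b), (a, c), (b, c), the element a ^ l b ^ (-j) c ^ k lies in its radical. -/
theorem IsTwoEngel.commutator_mem_center_of_exponent [Finite G] (h : IsTwoEngel G)
    (hE : IsEGroup G) (hgen : IsThreeGenerator G)
    (hn : 3 ∣ Monoid.exponent (Abelianization G)) (x y : G) : ⁅x, y⁆ ∈ center G := by
  obtain ⟨a, b, c, hgen⟩ := hgen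
  obtain ⟨k, hk⟩ := mem_zpowers_iff.1 (h.commutator_pow_exponent_mem_zpowers hgen a b)
  obtain ⟨j, hj⟩ := mem_zpowers_iff.1 (h.commutator_pow_exponent_mem_zpowers hgen a c)
  obtain ⟨l, hl⟩ := mem_zpowers_iff.1 (h.commutator_pow_exponent_mem_zpowers hgen b c)
  set T := ⁅a, ⁅b, c⁆⁆ with hT
  set n := Monoid.exponent (Abelianization G) with hn'
  have swap := IsTwoEngel.commutator_pow_swap (G := G)
  have trivial_of : ∀ w : G, ⁅a, w⁆ ^ n = 1 → ⁅b, w⁆ ^ n = 1 → ⁅c, w⁆ ^ n = 1 → ∀ y, ⁅y, w⁆ ^ n = 1 :=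
    fun w ha hb hc => forall_mem_of_closure_triple hgen (K := (h.commutatorPowHom hn w).ker)
      ha hb hc
  have expand : ∀ w : G, ⁅a ^ l * b ^ (-j) * c ^ k, w⁆ ^ n
      = (⁅a, w⁆ ^ n) ^ l * (⁅b, w⁆ ^ n) ^ (-j) * (⁅c, w⁆ ^ n) ^ k := fun w =>
    map_zpow_mul_zpow_mul_zpow (h.commutatorPowHom hn w) a b c l (-j) k
  have hx : ∀ y : G, ⁅a ^ l * b ^ (-j) * c ^ k, y⁆ ^ n = 1 := by
    intro y
    rw [swap, inv_eq_one]
    revert y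
    refine trivial_of _ ?_ ?_ ?_ <;> rw [swap, inv_eq_one, expand]
    · rw [commutatorElement_self, swap b a, swap c a, ← hk, ← hj, one_pow, one_zpow, one_mul,
        ← zpow_neg, ← zpow_neg, ← zpow_mul, ← zpow_mul, ← zpow_add]
      convert zpow_zero _; ring
    · rw [commutatorElement_self, swap c b, ← hk, ← hl, one_pow, one_zpow, mul_one,
        ← zpow_neg, ← zpow_mul, ← zpow_mul, ← zpow_add]
      convert zpow_zero _; ring
    · rw [commutatorElement_self, ← hj, ← hl, one_pow, one_zpow, mul_one,
        ← zpow_mul, ← zpow_mul, ← zpow_add]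
      convert zpow_zero _; ring
  -- Commutators with the radical element are killed by n, hence central. Expanding the resulting
  -- trivial triple commutators gives T ^ l = T ^ j = T ^ k = 1, so the whole form vanishes.
  have htau : ∀ y z : G, ⁅a ^ l * b ^ (-j) * c ^ k, ⁅y, z⁆⁆ = 1 := fun y z => by
    rw [h.commutator_rotate, h.commutator_swap_right, inv_eq_one,
      commutatorElement_eq_one_iff_commute]
    exact mem_center_iff.1 (hE.mem_center_of_pow_eq_one (hx z)) y
  have expand' : ∀ y z : G, ⁅a, ⁅y, z⁆⁆ ^ l * ⁅b, ⁅y, z⁆⁆ ^ (-j) * ⁅c, ⁅y, z⁆⁆ ^ k = 1 :=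
    fun y z => (map_zpow_mul_zpow_mul_zpow (h.tripleHom y z) a b c l (-j) k).symm.trans
      (htau y z)
  have hl' : T ^ l = 1 := by
    simpa [h.triple_self_left, h.triple_self_right] using expand' b c
  have hj' : T ^ j = 1 := by
    simpa [h.triple_self_left, h.triple_self_right, ← h.commutator_rotate a b c] using expand' c a
  have hk' : T ^ k = 1 := by
    simpa [h.triple_self_left, h.triple_self_right, h.commutator_rotate c a b] using expand' a b
  rw [hk'] at hk
  rw [hj'] at hj
  rw [hl'] at hl
  refine hE.mem_center_of_pow_eq_one ?_
  rw [← hn', swap, inv_eq_one]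
  revert y
  have h1 := trivial_of a (by simp) (by rw [swap, ← hk, inv_one]) (by rw [swap, ← hj, inv_one])
  have h2 := trivial_of b hk.symm (by simp) (by rw [swap, ← hl, inv_one])
  have h3 := trivial_of c hj.symm hl.symm (by simp)
  exact trivial_of x (by rw [swap, h1, inv_one]) (by rw [swap, h2, inv_one])
    (by rw [swap, h3, inv_one])

/-- Finite 3-generator `pE`-groups have class at most two. -/
theorem IsPEGroup.commutator_mem_center [Finite G] {p : ℕ} (hG : IsPEGroup p G)
    (hgen : IsThreeGenerator G) (x y : G) : ⁅x, y⁆ ∈ center G := by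
  have hp := hG.prime
  have : Fact p.Prime := ⟨hp⟩
  have h := hG.isEGroup.isTwoEngel
  rcases subsingleton_or_nontrivial G with hs | hs
  · rw [Subsingleton.elim ⁅x, y⁆ 1]; exact one_mem _
  by_cases h3 : p = 3
  · subst h3
    refine h.commutator_mem_center_of_exponent hG.isEGroup hgen ?_ x y
    obtain ⟨m, hm⟩ := exponent_eq_prime_pow hp hG.isPGroup
    rcases Nat.eq_zero_or_pos m with rfl | hpos
    -- Exponent 1 would make G perfect, impossible for a nontrivial nilpotent group.
    · exfalso
      have hnil : Group.IsNilpotent G := hG.isPGroup.isNilpotent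
      refine (Group.IsSolvable.commutator_lt_top_of_nontrivial G).ne ?_
      rw [eq_top_iff]
      intro g _
      have := pow_exponent_mem_commutator g
      rwa [hm, pow_zero, pow_one] at this
    · rw [hm]; exact dvd_pow_self 3 hpos.ne'
  · rw [mem_center_iff]
    intro z
    refine (commutatorElement_eq_one_iff_commute.1 ?_).eq
    obtain ⟨k, hk⟩ := hG.isPGroup ⁅z, ⁅x, y⁆⁆
    have h1 := orderOf_dvd_of_pow_eq_one hk
    have h2 := orderOf_dvd_of_pow_eq_one (h.triple_commutator_pow_three z x y)
    have hc : Nat.Coprime (p ^ k) 3 :=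
      Nat.Coprime.pow_left k ((Nat.coprime_primes hp Nat.prime_three).2 h3)
    exact orderOf_eq_one_iff.1 (Nat.eq_one_of_dvd_coprimes hc h1 h2)

end ClassTwo

/-! ### The commutator as an alternating form -/

section CommutatorForm

variable {G : Type*} [Group G]

/-- The group has nilpotency class at most two. -/
def IsClassTwo (G : Type*) [Group G] : Prop := ∀ x y : G, ⁅x, y⁆ ∈ center G

namespace IsClassTwo

variable (hc : IsClassTwo G)

/-- The commutator as a biadditive form with values in the center. -/
def form (x y : G) : Additive (center G) := Additive.ofMul ⟨⁅x, y⁆, hc x y⟩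

theorem form_mul_left (x x' y : G) : hc.form (x * x') y = hc.form x y + hc.form x' y := by
  refine congrArg Additive.ofMul (Subtype.ext ?_)
  change ⁅x * x', y⁆ = ⁅x, y⁆ * ⁅x', y⁆
  rw [commutatorElement_mul_left_eq_conj_mul, mem_center_iff.1 (hc x' y) x, mul_inv_cancel_right,
    mem_center_iff.1 (hc x' y)]

/-- The commutator form as a homomorphism in its first variable. -/
def formHom (y : G) : Additive G →+ Additive (center G) :=
  AddMonoidHom.mk' (fun x => hc.form x.toMul y) fun x x' => hc.form_mul_left x.toMul x'.toMul y

theorem form_zpow_left (x y : G) (k : ℤ) : hc.form (x ^ k) y = k • hc.form x y :=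
  map_zsmul (hc.formHom y) k (Additive.ofMul x)

theorem form_pow_left (x y : G) (k : ℕ) : hc.form (x ^ k) y = k • hc.form x y :=
  map_nsmul (hc.formHom y) k (Additive.ofMul x)

theorem form_inv_left (x y : G) : hc.form x⁻¹ y = - hc.form x y :=
  map_neg (hc.formHom y) (Additive.ofMul x)

theorem form_swap (x y : G) : hc.form x y = - hc.form y x := by
  refine congrArg Additive.ofMul (Subtype.ext ?_)
  exact (commutatorElement_inv y x).symm

theorem form_mul_right (x y y' : G) : hc.form x (y * y') = hc.form x y + hc.form x y' := by
  rw [hc.form_swap, form_mul_left, hc.form_swap x y, hc.form_swap x y', neg_add]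

theorem form_zpow_right (x y : G) (k : ℤ) : hc.form x (y ^ k) = k • hc.form x y := by
  rw [hc.form_swap, form_zpow_left, hc.form_swap x y, smul_neg]

theorem form_eq_zero_iff {x y : G} : hc.form x y = 0 ↔ Commute x y := by
  rw [← commutatorElement_eq_one_iff_commute]
  exact ⟨fun h => congrArg (fun z : Additive (center G) => (z.toMul : G)) h,
    fun h => congrArg Additive.ofMul (Subtype.ext h)⟩

theorem form_self (x : G) : hc.form x x = 0 := hc.form_eq_zero_iff.2 (Commute.refl x)

theorem mem_center_iff_form {x : G} : x ∈ center G ↔ ∀ y, hc.form x y = 0 := by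
  simp only [mem_center_iff, form_eq_zero_iff, commute_iff_eq, eq_comm]

theorem nsmul_form_eq_zero_iff {x y : G} {k : ℕ} : k • hc.form x y = 0 ↔ ⁅x, y⁆ ^ k = 1 :=
  ⟨fun h => congrArg (fun z : Additive (center G) => (z.toMul : G)) h,
    fun h => congrArg Additive.ofMul (Subtype.ext h)⟩

include hc

theorem commutator_le_center : commutator G ≤ center G := by
  rw [commutator_eq_closure, closure_le]
  rintro _ ⟨x, y, rfl⟩
  exact hc x y

theorem exponent_nsmul_form (x y : G) :
    Monoid.exponent (Abelianization G) • hc.form x y = 0 := by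
  rw [← form_pow_left]
  exact hc.mem_center_iff_form.1 (hc.commutator_le_center (pow_exponent_mem_commutator x)) y

theorem mul_pow_eq (x y : G) (k : ℕ) : (x * y) ^ k = x ^ k * y ^ k * ⁅y, x⁆ ^ k.choose 2 := by
  have hz : ∀ z, Commute ⁅y, x⁆ z := fun z => (mem_center_iff.1 (hc y x) z).symm
  have e : ∀ k : ℕ, y ^ k * x = x * y ^ k * ⁅y, x⁆ ^ k := by
    intro k
    induction k with
    | zero => simp
    | succ k ih =>
      have h1 : y * x = x * y * ⁅y, x⁆ := by
        rw [← (hz _).eq, commutatorElement_def]; group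
      calc y ^ (k + 1) * x = y * (y ^ k * x) := by rw [pow_succ', mul_assoc]
        _ = y * x * y ^ k * ⁅y, x⁆ ^ k := by rw [ih]; simp only [mul_assoc]
        _ = x * y * (⁅y, x⁆ * y ^ k) * ⁅y, x⁆ ^ k := by rw [h1]; simp only [mul_assoc]
        _ = x * (y * y ^ k) * (⁅y, x⁆ * ⁅y, x⁆ ^ k) := by
          rw [(hz _).eq]; simp only [mul_assoc]
        _ = _ := by rw [← pow_succ', ← pow_succ']
  induction k with
  | zero => simp
  | succ k ih =>
    have hz' : ∀ z, ⁅y, x⁆ ^ k.choose 2 * z = z * ⁅y, x⁆ ^ k.choose 2 :=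
      fun z => ((hz z).pow_left _).eq
    calc (x * y) ^ (k + 1) = x ^ k * y ^ k * (⁅y, x⁆ ^ k.choose 2 * (x * y)) := by
          rw [pow_succ, ih, mul_assoc]
      _ = x ^ k * (y ^ k * x) * y * ⁅y, x⁆ ^ k.choose 2 := by
          rw [hz']; simp only [mul_assoc]
      _ = x ^ k * x * y ^ k * (⁅y, x⁆ ^ k * y) * ⁅y, x⁆ ^ k.choose 2 := by
          rw [e]; simp only [mul_assoc]
      _ = (x ^ k * x) * (y ^ k * y) * (⁅y, x⁆ ^ k * ⁅y, x⁆ ^ k.choose 2) := by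
          rw [((hz y).pow_left k).eq]; simp only [mul_assoc]
      _ = _ := by
          rw [← pow_succ, ← pow_succ, ← pow_add, Nat.choose_succ_succ' k 1, Nat.choose_one_right]

end IsClassTwo

end CommutatorForm

/-! ### The last layer of commutator powers is not cyclic -/

section Noncyclic

variable {G : Type*} [Group G]

/-- Right multiplication by `u` off the centralizer of `u`, a homomorphism if all nontrivial
commutators with `u` equal `u ^ 2` and `u ^ 4 = 1`. -/
theorem exists_hom_eq_mul_of_not_commute (hc : IsClassTwo G) {u : G} (hu : u ^ 4 = 1)
    (h : ∀ x, ¬ Commute x u → ⁅x, u⁆ = u ^ 2) :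
    ∃ f : G →* G, ∀ x, ¬ Commute x u → f x = x * u := by
  classical
  refine ⟨MonoidHom.mk' (fun x => if Commute x u then x else x * u) ?_, fun x hx => if_neg hx⟩
  intro x y
  by_cases hx : Commute x u <;> by_cases hy : Commute y u
  · simp [hx, hy, hx.mul_left hy]
  · have : ¬ Commute (x * y) u := fun hxy => hy (by simpa using hx.inv_left.mul_left hxy)
    simp [hx, hy, this, mul_assoc]
  · have : ¬ Commute (x * y) u := fun hxy => hx (by simpa using hxy.mul_left hy.inv_left)
    simp [hx, hy, this, mul_assoc, hy.eq]
  · have h1 : Commute (x * y) u := by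
      rw [← hc.form_eq_zero_iff, hc.form_mul_left]
      refine congrArg Additive.ofMul (Subtype.ext ?_)
      change ⁅x, u⁆ * ⁅y, u⁆ = 1
      rw [h x hx, h y hy, ← pow_add, hu]
    have h2 : y * u = u ^ 2 * (u * y) := by
      rw [← h y hy, commutatorElement_def]; group
    have hz : ∀ z, z * u ^ 2 = u ^ 2 * z := mem_center_iff.1 (h y hy ▸ hc y u)
    simp only [hx, hy, h1, if_true, if_false]
    calc x * y = x * (u ^ 4 * y) := by rw [hu, one_mul]
      _ = x * (u * (u ^ 2 * (u * y))) := by simp only [pow_succ, pow_zero, one_mul, mul_assoc]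
      _ = x * u * (y * u) := by rw [← h2, mul_assoc]

/-- This kills the commutator term in (x * y) ^ p ^ (m + s), making that power map additive. It
fails for p = 2, m = 1, s = 0. -/
theorem pow_dvd_choose_two {p m s : ℕ} (hp : p.Prime) (hsm : s + 1 ≤ m)
    (h : p = 2 → 2 ≤ m) : p ^ (s + 1) ∣ (p ^ (m + s)).choose 2 := by
  rcases hp.eq_two_or_odd' with rfl | hodd
  · have hm := h rfl
    obtain ⟨k, hk⟩ : ∃ k, m + s = (s + 1) + k + 1 := ⟨m - 2, by omega⟩
    rw [hk, show 2 ^ (s + 1 + k + 1) = 2 ^ (s + 1) * 2 ^ k * 2 by ring, Nat.choose_two_right,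
      mul_right_comm, Nat.mul_div_cancel _ two_pos, mul_assoc]
    exact dvd_mul_right _ _
  · have h1 : p ^ (s + 1) ∣ p ^ (m + s) * (p ^ (m + s) - 1) :=
      (pow_dvd_pow p (by omega)).mul_right _
    have h2 : (p ^ (m + s)).choose 2 * 2 = p ^ (m + s) * (p ^ (m + s) - 1) := by
      rw [Nat.choose_two_right, Nat.div_mul_cancel (Nat.even_mul_pred_self _).two_dvd]
    rw [← h2] at h1
    exact (Nat.Coprime.pow_left _ (Nat.coprime_two_right.2 hodd)).dvd_of_dvd_mul_right h1

/-- In a nonabelian finite `pE`-group of class two, the last nontrivial subgroup of `p`-powers of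
commutators is not generated by the power of one commutator. -/
theorem IsPEGroup.not_forall_pow_mem_zpowers [Finite G] {p : ℕ} (hG : IsPEGroup p G)
    (hc : IsClassTwo G) {s : ℕ} (hs : ∀ x y : G, ⁅x, y⁆ ^ p ^ (s + 1) = 1) {u v : G}
    (huv : ⁅u, v⁆ ^ p ^ s ≠ 1) : ¬ ∀ x y : G, ⁅x, y⁆ ^ p ^ s ∈ zpowers (⁅u, v⁆ ^ p ^ s) := by
  intro hcyc
  have hp := hG.prime
  have : Fact p.Prime := ⟨hp⟩
  obtain ⟨m, hm⟩ := exponent_eq_prime_pow hp hG.isPGroup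
  have hΩ : ∀ g : G, g ^ p ^ m = 1 → g ∈ center G := fun g hg =>
    hG.isEGroup.mem_center_of_pow_eq_one (hm ▸ hg)
  set ζ := ⁅u, v⁆ ^ p ^ s with hζ
  have hζp : ζ ^ p = 1 := by rw [hζ, ← pow_mul, ← pow_succ]; exact hs u v
  have hord : orderOf ζ = p := orderOf_eq_prime hζp huv
  have hsm : s + 1 ≤ m := by
    by_contra hlt
    apply huv
    have h1 := hc.exponent_nsmul_form u v
    rw [hm] at h1
    rw [← orderOf_dvd_iff_pow_eq_one]
    exact (orderOf_dvd_of_pow_eq_one (hc.nsmul_form_eq_zero_iff.1 h1)).trans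
      (pow_dvd_pow p (by omega))
  have hderived : ∀ d ∈ commutator G, d ^ p ^ s ∈ zpowers ζ := by
    intro d hd
    rw [commutator_eq_closure] at hd
    induction hd using closure_induction with
    | mem d hd => obtain ⟨x, y, rfl⟩ := hd; exact hcyc x y
    | one => simp
    | mul d d' hd _ h h' =>
      have hz := hc.commutator_le_center (commutator_eq_closure G ▸ hd)
      have : Commute d d' := (mem_center_iff.1 hz d').symm
      rw [this.mul_pow]
      exact mul_mem h h'
    | inv d _ h => rw [inv_pow]; exact inv_mem h
  have hN : ∀ x : G, x ^ p ^ (m + s) ∈ zpowers ζ := fun x => by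
    rw [pow_add, pow_mul]
    exact hderived _ (hm ▸ pow_exponent_mem_commutator x)
  -- If x ^ p ^ (m + s) = 1, then x ^ p ^ s is killed by p ^ m, hence central.
  have hne : ∀ x y : G, ⁅x, y⁆ ^ p ^ s ≠ 1 → x ^ p ^ (m + s) ≠ 1 := fun x y hxy hx => by
    apply hxy
    rw [add_comm, pow_add, pow_mul] at hx
    rw [← hc.nsmul_form_eq_zero_iff, ← hc.form_pow_left]
    exact hc.mem_center_iff_form.1 (hΩ _ hx) y
  have hprime : Prime (p : ℤ) := Nat.prime_iff_prime_int.1 hp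
  obtain ⟨i, hi⟩ := mem_zpowers_iff.1 (hN u)
  obtain ⟨j, hj⟩ := mem_zpowers_iff.1 (hN v)
  have hpi : ¬ (p : ℤ) ∣ i := fun hd => hne u v huv <| by
    rw [← hi, ← orderOf_dvd_iff_zpow_eq_one, hord]; exact hd
  by_cases hcase : p = 2 → 2 ≤ m
  · obtain ⟨a, b, hab⟩ := (hprime.coprime_iff_not_dvd.2 hpi)
    -- Since b inverts i modulo p, this w has trivial p ^ (m + s)-th power, yet ⁅w, u⁆ = ⁅v, u⁆,
    -- contradicting `hne`.
    set w := v * u ^ (-(b * j)) with hw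
    have hform : hc.form w u = hc.form v u := by
      rw [hw, hc.form_mul_left, hc.form_zpow_left, hc.form_self, smul_zero, add_zero]
    have hwu : ⁅w, u⁆ ^ p ^ s ≠ 1 := by
      rw [Ne, ← hc.nsmul_form_eq_zero_iff, hform, hc.form_swap, smul_neg, neg_eq_zero,
        hc.nsmul_form_eq_zero_iff]
      exact huv
    refine hne w u hwu ?_
    obtain ⟨c, hcc⟩ := pow_dvd_choose_two hp hsm hcase
    rw [hw, hc.mul_pow_eq, hcc, pow_mul, hs, one_pow, mul_one, ← zpow_natCast (u ^ _), ← zpow_mul,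
      mul_comm _ (((p ^ (m + s) : ℕ) : ℤ)), zpow_mul, zpow_natCast, ← hi, ← hj, ← zpow_mul,
      ← zpow_add]
    rw [← orderOf_dvd_iff_zpow_eq_one, hord]
    exact ⟨a * j, by linear_combination (-j) * hab⟩
  -- In the exceptional case the derived subgroup is {1, ζ} and u ^ 2 = ζ; an explicit endomorphism
  -- sends v to v * u, which does not commute with v.
  · push Not at hcase
    obtain ⟨rfl, hm2⟩ := hcase
    obtain rfl : m = 1 := by omega
    obtain rfl : s = 0 := by omega
    have hζ' : ∀ x ∈ zpowers ζ, x ≠ 1 → x = ζ := by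
      intro x hx hx1
      obtain ⟨k, rfl⟩ := mem_zpowers_iff.1 hx
      rcases Int.even_or_odd' k with ⟨k, rfl | rfl⟩
      · exfalso; apply hx1
        rw [zpow_mul, show ζ ^ (2 : ℤ) = 1 from by exact_mod_cast hζp, one_zpow]
      · rw [zpow_add, zpow_mul, show ζ ^ (2 : ℤ) = 1 from by exact_mod_cast hζp]; simp
    have hu2 : u ^ 2 = ζ := hζ' _ (hN u) (hne u v huv)
    obtain ⟨f, hf⟩ := exists_hom_eq_mul_of_not_commute hc (u := u)
      (by rw [show 4 = 2 * 2 from rfl, pow_mul, hu2, hζp]) (fun x hx => by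
        rw [hu2]
        refine hζ' _ (by simpa using hcyc x u) ?_
        rwa [Ne, commutatorElement_eq_one_iff_commute])
    have hvu : ¬ Commute v u := fun h => huv <| by
      rw [hζ, commutatorElement_eq_one_iff_commute.2 h.symm, one_pow]
    have h1 := hG.isEGroup f v
    rw [hf v hvu] at h1
    exact hvu (by simpa using (Commute.refl v).inv_right.mul_right h1)

end Noncyclic

/-! ### Adapted generating triples -/

section AdaptedTriple

variable {G : Type*} [Group G]

namespace IsClassTwo

variable (hc : IsClassTwo G)

theorem form_mem_of_closure_triple {a b c : G} (hgen : closure {a, b, c} = ⊤)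
    {L : AddSubgroup (Additive (center G))} (h1 : hc.form b c ∈ L) (h2 : hc.form c a ∈ L)
    (h3 : hc.form a b ∈ L) (x y : G) : hc.form x y ∈ L := by
  have key : ∀ w, hc.form a w ∈ L → hc.form b w ∈ L → hc.form c w ∈ L → ∀ x, hc.form x w ∈ L :=
    fun w ha hb hc' => forall_mem_of_closure_triple hgen
      (K := AddSubgroup.toSubgroup' (L.comap (hc.formHom w))) ha hb hc'
  have swap : ∀ x y, hc.form x y ∈ L → hc.form y x ∈ L := fun x y h => by
    rw [hc.form_swap]; exact neg_mem h
  have self : ∀ x, hc.form x x ∈ L := fun x => by rw [hc.form_self]; exact zero_mem L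
  have ha := key a (self a) (swap _ _ h3) h2
  have hb := key b h3 (self b) (swap _ _ h1)
  have hc' := key c (swap _ _ h2) h1 (self c)
  exact key y (swap _ _ (ha y)) (swap _ _ (hb y)) (swap _ _ (hc' y)) x

end IsClassTwo

theorem closure_triple_mul_zpow {a b c : G} (hgen : closure {a, b, c} = ⊤) (i j : ℤ) :
    closure {a, b * a ^ i, c * a ^ j} = ⊤ := by
  set K := closure {a, b * a ^ i, c * a ^ j}
  have ha : a ∈ K := subset_closure (by simp)
  have hb : b * a ^ i ∈ K := subset_closure (by simp)
  have hc : c * a ^ j ∈ K := subset_closure (by simp)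
  rw [eq_top_iff]
  intro x _
  refine forall_mem_of_closure_triple hgen ha ?_ ?_ x
  · simpa using mul_mem hb (zpow_mem ha (-i))
  · simpa using mul_mem hc (zpow_mem ha (-j))

theorem exists_zpow_mul_mem_commutator {a b c : G} (hgen : closure {a, b, c} = ⊤) (x : G) :
    ∃ (i j k : ℤ), ∃ d ∈ commutator G, x = a ^ i * b ^ j * c ^ k * d := by
  let q : G →* Abelianization G := Abelianization.of
  have hx : q x ∈ zpowers (q a) ⊔ zpowers (q b) ⊔ zpowers (q c) :=
    forall_mem_of_closure_triple hgen
      (K := (zpowers (q a) ⊔ zpowers (q b) ⊔ zpowers (q c)).comap q)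
      (mem_sup_left (mem_sup_left (mem_zpowers _)))
      (mem_sup_left (mem_sup_right (mem_zpowers _)))
      (mem_sup_right (mem_zpowers _)) x
  obtain ⟨_, hy, _, ⟨k, rfl⟩, hx⟩ := mem_sup.1 hx
  obtain ⟨_, ⟨i, rfl⟩, _, ⟨j, rfl⟩, rfl⟩ := mem_sup.1 hy
  refine ⟨i, j, k, (a ^ i * b ^ j * c ^ k)⁻¹ * x, ?_, by group⟩
  rw [← Abelianization.ker_of G, MonoidHom.mem_ker, map_mul, map_inv,
    map_zpow_mul_zpow_mul_zpow, inv_mul_eq_one]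
  exact hx

namespace IsClassTwo

variable (hc : IsClassTwo G)

theorem form_zpow_mul_zpow_mul_zpow_mul (a b c : G) (i j k : ℤ) {d : G} (hd : d ∈ commutator G)
    (y : G) : hc.form (a ^ i * b ^ j * c ^ k * d) y
      = i • hc.form a y + j • hc.form b y + k • hc.form c y := by
  rw [hc.form_mul_left, hc.form_mul_left, hc.form_mul_left, hc.form_zpow_left, hc.form_zpow_left,
    hc.form_zpow_left, hc.mem_center_iff_form.1 (hc.commutator_le_center hd), add_zero]

/-- A generating triple such that every relation modulo `p` among the `p ^ s`-th powers of its
commutators involves only the commutator of the last two generators. -/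
structure IsAdapted (p s : ℕ) (a b c : G) : Prop where
  closure_eq_top : closure {a, b, c} = ⊤
  dvd_of_relation : ∀ i j k : ℤ,
    p ^ s • (i • hc.form b c + j • hc.form c a + k • hc.form a b) = 0 → (p : ℤ) ∣ j ∧ (p : ℤ) ∣ k

end IsClassTwo

section Finite

variable [Finite G] {p : ℕ} (hG : IsPEGroup p G) (hc : IsClassTwo G) {s : ℕ}
  (hs : ∀ x y : G, p ^ (s + 1) • hc.form x y = 0) {u v : G} (huv : p ^ s • hc.form u v ≠ 0)

include hG hs huv

theorem IsPEGroup.not_forall_form_mem_zmultiples (u' v' : G) :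
    ¬ ∀ x y : G, p ^ s • hc.form x y ∈ AddSubgroup.zmultiples (p ^ s • hc.form u' v') := by
  intro h
  by_cases h0 : p ^ s • hc.form u' v' = 0
  · rw [h0] at h
    exact huv (by simpa using h u v)
  · refine hG.not_forall_pow_mem_zpowers hc (fun x y => hc.nsmul_form_eq_zero_iff.1 (hs x y))
      (fun h1 => h0 (hc.nsmul_form_eq_zero_iff.2 h1)) fun x y => ?_
    obtain ⟨k, hk⟩ := h x y
    exact ⟨k, congrArg (fun z : Additive (center G) => (z.toMul : G)) hk⟩

/-- In rank three every bivector is decomposable: with β inverse to i modulo p, shifting b and c by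
powers of a turns the relation into p ^ s • [b', c'] = 0. A further relation would make the layer
cyclic. -/
theorem IsPEGroup.exists_isAdapted_of_not_dvd {a b c : G} (hgen : closure {a, b, c} = ⊤)
    {i j k : ℤ} (hrel : p ^ s • (i • hc.form b c + j • hc.form c a + k • hc.form a b) = 0)
    (hi : ¬ (p : ℤ) ∣ i) : ∃ a b c : G, hc.IsAdapted p s a b c := by
  have hprime : Prime (p : ℤ) := Nat.prime_iff_prime_int.1 hG.prime
  have hps : ∀ x y : G, (p : ℤ) • (p ^ s • hc.form x y) = 0 := fun x y => by
    have := hs x y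
    rw [pow_succ', mul_smul] at this
    rwa [natCast_zsmul]
  obtain ⟨α, β, hαβ⟩ := hprime.coprime_iff_not_dvd.2 hi
  set b' := b * a ^ (-(β * j)) with hb'
  set c' := c * a ^ (-(β * k)) with hc'
  have hgen' : closure {a, b', c'} = ⊤ := closure_triple_mul_zpow hgen _ _
  have hX : p ^ s • hc.form b' c' = 0 := by
    have e : hc.form b' c' = hc.form b c + (β * j) • hc.form c a + (β * k) • hc.form a b := by
      rw [hb', hc', hc.form_mul_left, hc.form_mul_right, hc.form_mul_right, hc.form_zpow_left,
        hc.form_zpow_left, hc.form_zpow_right, hc.form_zpow_right, hc.form_self,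
        hc.form_swap b a, hc.form_swap a c]
      module
    have e2 : p ^ s • hc.form b' c' = α • ((p : ℤ) • (p ^ s • hc.form b c)) +
        β • (p ^ s • (i • hc.form b c + j • hc.form c a + k • hc.form a b)) := by
      rw [e]
      have : hc.form b c = (α * p + β * i) • hc.form b c := by rw [hαβ, one_smul]
      nth_rewrite 1 [this]
      module
    rw [e2, hps, hrel, smul_zero, smul_zero, add_zero]
  have cyclic : ∀ t, p ^ s • hc.form c' a ∈ AddSubgroup.zmultiples (p ^ s • t) →
      p ^ s • hc.form a b' ∈ AddSubgroup.zmultiples (p ^ s • t) →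
      ∀ x y, p ^ s • hc.form x y ∈ AddSubgroup.zmultiples (p ^ s • t) := fun t h1 h2 =>
    hc.form_mem_of_closure_triple hgen'
      (L := (AddSubgroup.zmultiples (p ^ s • t)).comap
        (DistribSMul.toAddMonoidHom (Additive (center G)) (p ^ s)))
      (by
        change p ^ s • hc.form b' c' ∈ AddSubgroup.zmultiples (p ^ s • t)
        rw [hX]; exact zero_mem _) h1 h2
  have dvd : ∀ {x y x' y' : G} {j k : ℤ},
      p ^ s • (j • hc.form x y + k • hc.form x' y') = 0 → ¬ (p : ℤ) ∣ j →
      p ^ s • hc.form x y ∈ AddSubgroup.zmultiples (p ^ s • hc.form x' y') := by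
    intro x y x' y' j k h hj
    obtain ⟨γ, δ, hγδ⟩ := hprime.coprime_iff_not_dvd.2 hj
    refine AddSubgroup.mem_zmultiples_iff.2 ⟨-(δ * k), ?_⟩
    have : hc.form x y = (γ * p + δ * j) • hc.form x y := by rw [hγδ, one_smul]
    rw [this]
    have e : p ^ s • (γ * ↑p + δ * j) • hc.form x y = γ • ((p : ℤ) • (p ^ s • hc.form x y))
        + δ • (p ^ s • (j • hc.form x y + k • hc.form x' y'))
        - (δ * k) • (p ^ s • hc.form x' y') := by module
    rw [e, hps, h]
    module
  refine ⟨a, b', c', hgen', fun i j k h => ?_⟩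
  have h' : p ^ s • (j • hc.form c' a + k • hc.form a b') = 0 := by
    have e : p ^ s • (i • hc.form b' c' + j • hc.form c' a + k • hc.form a b') =
      i • (p ^ s • hc.form b' c') + p ^ s • (j • hc.form c' a + k • hc.form a b') := by module
    rwa [e, hX, smul_zero, zero_add] at h
  constructor
  · by_contra hj
    exact hG.not_forall_form_mem_zmultiples hc hs huv a b'
      (cyclic _ (dvd h' hj) (AddSubgroup.mem_zmultiples _))
  · by_contra hk
    rw [add_comm] at h'
    exact hG.not_forall_form_mem_zmultiples hc hs huv c' a
      (cyclic _ (AddSubgroup.mem_zmultiples _) (dvd h' hk))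

theorem IsPEGroup.exists_isAdapted (hgen : IsThreeGenerator G) :
    ∃ a b c : G, hc.IsAdapted p s a b c := by
  obtain ⟨a, b, c, hgen⟩ := hgen
  by_contra hno
  have key : ∀ {a b c : G}, closure {a, b, c} = ⊤ → ∀ {i j k : ℤ},
      p ^ s • (i • hc.form b c + j • hc.form c a + k • hc.form a b) = 0 → (p : ℤ) ∣ i := by
    intro a b c hgen i j k hrel
    by_contra hi
    exact hno (hG.exists_isAdapted_of_not_dvd hc hs huv hgen hrel hi)
  -- If no triple is adapted, every relation has first coefficient divisible by p. Rotating the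
  -- generators gives this for the other two, so the given triple is adapted after all.
  refine hno ⟨a, b, c, hgen, fun i j k hrel => ⟨?_, ?_⟩⟩
  · refine key (a := b) (b := c) (c := a) (i := j) (j := k) (k := i) ?_ ?_
    · rw [← hgen]; congr 1; ext; simp only [Set.mem_insert_iff, Set.mem_singleton_iff]; tauto
    · rw [← hrel]; module
  · refine key (a := c) (b := a) (c := b) (i := k) (j := i) (k := j) ?_ ?_
    · rw [← hgen]; congr 1; ext; simp only [Set.mem_insert_iff, Set.mem_singleton_iff]; tauto
    · rw [← hrel]; module

end Finite

end AdaptedTriple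

/-! ### Endomorphisms act as 0 or 1 modulo the center -/

section Endomorphism

variable {G : Type*} [Group G]

namespace IsClassTwo

variable (hc : IsClassTwo G)

theorem form_map_self (hE : IsEGroup G) (f : G →* G) (x : G) : hc.form (f x) x = 0 :=
  hc.form_eq_zero_iff.2 (hE f x).symm

theorem form_map_add_form_map (hE : IsEGroup G) (f : G →* G) (x y : G) :
    hc.form (f x) y + hc.form (f y) x = 0 := by
  have h := hc.form_map_self hE f (x * y)
  rw [map_mul, hc.form_mul_left, hc.form_mul_right, hc.form_mul_right, hc.form_map_self hE,
    hc.form_map_self hE] at h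
  simpa using h

theorem form_map_left_eq (hE : IsEGroup G) (f : G →* G) (x y : G) :
    hc.form (f x) y = hc.form x (f y) := by
  rw [hc.form_swap x, ← sub_eq_zero, sub_neg_eq_add, hc.form_map_add_form_map hE]

theorem IsAdapted.pow_dvd_of_relation {p s : ℕ} {a b c : G} {hc : IsClassTwo G}
    (h : hc.IsAdapted p s a b c) {t : ℕ} (ht : t ≤ s) {i j k : ℤ} (hi : (p : ℤ) ^ t ∣ i)
    (hj : (p : ℤ) ^ t ∣ j) (hk : (p : ℤ) ^ t ∣ k)
    (hrel : i • hc.form b c + j • hc.form c a + k • hc.form a b = 0) :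
    (p : ℤ) ^ (t + 1) ∣ j ∧ (p : ℤ) ^ (t + 1) ∣ k := by
  obtain ⟨i, rfl⟩ := hi
  obtain ⟨j, rfl⟩ := hj
  obtain ⟨k, rfl⟩ := hk
  obtain ⟨r, rfl⟩ := Nat.exists_eq_add_of_le ht
  have h1 : p ^ (t + r) • (i • hc.form b c + j • hc.form c a + k • hc.form a b) = 0 := by
    have := congrArg (p ^ r • ·) hrel
    simp only [smul_zero] at this
    rw [← this]
    module
  obtain ⟨h2, h3⟩ := h.dvd_of_relation i j k h1
  rw [pow_succ]
  exact ⟨mul_dvd_mul_left _ h2, mul_dvd_mul_left _ h3⟩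

/-- Endomorphisms act as scalars modulo the center. -/
theorem IsAdapted.exists_form_map_eq_zsmul {p s : ℕ} {a b c : G} {hc : IsClassTwo G}
    (h : hc.IsAdapted p s a b c) (hs : ∀ x y : G, p ^ (s + 1) • hc.form x y = 0)
    (hE : IsEGroup G) (f : G →* G) :
    ∃ l : ℤ, ∀ x y : G, hc.form (f x) y = l • hc.form x y := by
  have coeff : ∀ x : G, ∃ i j k : ℤ, ∀ y, hc.form x y
      = i • hc.form a y + j • hc.form b y + k • hc.form c y := fun x => by
    obtain ⟨i, j, k, d, hd, rfl⟩ := exists_zpow_mul_mem_commutator h.closure_eq_top x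
    exact ⟨i, j, k, hc.form_zpow_mul_zpow_mul_zpow_mul a b c i j k hd⟩
  obtain ⟨a₁, a₂, a₃, ha⟩ := coeff (f a)
  obtain ⟨b₁, b₂, b₃, hb⟩ := coeff (f b)
  obtain ⟨c₁, c₂, c₃, hcc⟩ := coeff (f c)
  have swaps := And.intro (hc.form_swap b a) (And.intro (hc.form_swap c b) (hc.form_swap a c))
  have raa : (0 : ℤ) • hc.form b c + a₃ • hc.form c a + (-a₂) • hc.form a b = 0 := by
    have := hc.form_map_self hE f a
    rw [ha, hc.form_self, swaps.1] at this
    rw [← this]; module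
  have rbb : (-b₃) • hc.form b c + (0 : ℤ) • hc.form c a + b₁ • hc.form a b = 0 := by
    have := hc.form_map_self hE f b
    rw [hb, hc.form_self, swaps.2.1] at this
    rw [← this]; module
  have rcc : c₂ • hc.form b c + (-c₁) • hc.form c a + (0 : ℤ) • hc.form a b = 0 := by
    have := hc.form_map_self hE f c
    rw [hcc, hc.form_self, swaps.2.2] at this
    rw [← this]; module
  have rab : (-a₃) • hc.form b c + b₃ • hc.form c a + (a₁ - b₂) • hc.form a b = 0 := by
    have := hc.form_map_add_form_map hE f a b
    rw [ha, hb, hc.form_self, hc.form_self, swaps.1, swaps.2.1] at this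
    rw [← this]; module
  have rac : a₂ • hc.form b c + (c₃ - a₁) • hc.form c a + (-c₂) • hc.form a b = 0 := by
    have := hc.form_map_add_form_map hE f a c
    rw [ha, hcc, hc.form_self, hc.form_self, swaps.1, swaps.2.2] at this
    rw [← this]; module
  have rbc : (b₂ - c₃) • hc.form b c + (-b₁) • hc.form c a + c₁ • hc.form a b = 0 := by
    have := hc.form_map_add_form_map hE f b c
    rw [hb, hcc, hc.form_self, hc.form_self, swaps.2.1, swaps.2.2] at this
    rw [← this]; module
  -- Adaptedness controls only the second and third coefficients of a relation. Each off-diagonal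
  -- entry and both diagonal differences occur there in `raa`, `rab`, `rac` or `rbc`, so
  -- divisibility climbs one power of p at a time.
  have key : ∀ t ≤ s + 1, (p : ℤ) ^ t ∣ a₂ ∧ (p : ℤ) ^ t ∣ a₃ ∧ (p : ℤ) ^ t ∣ b₁ ∧
      (p : ℤ) ^ t ∣ b₃ ∧ (p : ℤ) ^ t ∣ c₁ ∧ (p : ℤ) ^ t ∣ c₂ ∧ (p : ℤ) ^ t ∣ a₁ - b₂ ∧
      (p : ℤ) ^ t ∣ c₃ - a₁ := by
    intro t
    induction t with
    | zero => simp
    | succ t ih =>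
      intro ht
      obtain ⟨h1, h2, h3, h4, h5, h6, h7, h8⟩ := ih (by omega)
      have ht' : t ≤ s := by omega
      have h9 : (p : ℤ) ^ t ∣ b₂ - c₃ := by
        rw [show b₂ - c₃ = -((a₁ - b₂) + (c₃ - a₁)) by ring, dvd_neg]
        exact dvd_add h7 h8
      have s1 := h.pow_dvd_of_relation ht' (dvd_zero _) h2 ((dvd_neg).2 h1) raa
      have s4 := h.pow_dvd_of_relation ht' ((dvd_neg).2 h2) h4 h7 rab
      have s5 := h.pow_dvd_of_relation ht' h1 h8 ((dvd_neg).2 h6) rac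
      have s6 := h.pow_dvd_of_relation ht' h9 ((dvd_neg).2 h3) h5 rbc
      exact ⟨dvd_neg.1 s1.2, s1.1, dvd_neg.1 s6.1, s4.1, s6.2, dvd_neg.1 s5.2, s4.2, s5.1⟩
  obtain ⟨h1, h2, h3, h4, h5, h6, h7, h8⟩ := key (s + 1) le_rfl
  have kill : ∀ {k : ℤ}, (p : ℤ) ^ (s + 1) ∣ k → ∀ x y, k • hc.form x y = 0 := by
    rintro _ ⟨k, rfl⟩ x y
    rw [mul_comm, mul_smul, ← Nat.cast_pow, natCast_zsmul, hs, smul_zero]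
  refine ⟨a₁, fun x y => ?_⟩
  rw [← sub_eq_zero]
  refine forall_mem_of_closure_triple h.closure_eq_top
    (K := AddSubgroup.toSubgroup'
      ((hc.formHom y).comp (MonoidHom.toAdditive f) - a₁ • hc.formHom y).ker) ?_ ?_ ?_ x
  · change hc.form (f a) y - a₁ • hc.form a y = 0
    rw [ha, kill h1, kill h2]; module
  · change hc.form (f b) y - a₁ • hc.form b y = 0
    have := kill h7 b y
    rw [hb, kill h3, kill h4, zero_add, add_zero, ← neg_eq_zero, ← this]; module
  · change hc.form (f c) y - a₁ • hc.form c y = 0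
    have := kill h8 c y
    rw [hcc, kill h5, kill h6, zero_add, zero_add, ← this]; module

theorem map_eq_zpow_of_mem_commutator {f : G →* G} {k : ℤ}
    (hf : ∀ x y, hc.form (f x) (f y) = k • hc.form x y) {d : G} (hd : d ∈ commutator G) :
    f d = d ^ k := by
  rw [commutator_eq_closure] at hd
  induction hd using closure_induction with
  | mem d hd =>
    obtain ⟨x, y, rfl⟩ := hd
    rw [map_commutatorElement]
    exact congrArg (fun z : Additive (center G) => (z.toMul : G)) (hf x y)
  | one => simp
  | mul d d' hd _ h h' =>
    have hz := hc.commutator_le_center (commutator_eq_closure G ▸ hd)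
    have : Commute d d' := (mem_center_iff.1 hz d').symm
    rw [map_mul, h, h', this.mul_zpow]
  | inv d _ h => rw [map_inv, h, inv_zpow]

/-- The scalar by which an endomorphism acts modulo the center is idempotent. -/
theorem zsmul_form_eq_zero_of_form_map [Finite G] (hE : IsEGroup G) {f : G →* G} {l : ℤ}
    (hf : ∀ x y : G, hc.form (f x) y = l • hc.form x y) (x y : G) :
    (l * (l - 1)) • hc.form x y = 0 := by
  have hf2 : ∀ x y, hc.form (f x) (f y) = (l * l) • hc.form x y := fun x y => by
    rw [hf, ← hc.form_map_left_eq hE, hf, mul_smul]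
  have h1 := hc.map_eq_zpow_of_mem_commutator hf2 (pow_exponent_mem_commutator x)
  have hcomm : Commute (x ^ (l * l)) (f x)⁻¹ := ((hE f x).zpow_left _).inv_right
  -- On G' the map f is the l²-th power, and x ^ n lies in G'; so the commuting elements x ^ (l * l)
  -- and f x have equal n-th powers.
  have h2 : x ^ (l * l) * (f x)⁻¹ ∈ center G := hE.mem_center_of_pow_eq_one <| by
    rw [hcomm.mul_pow, inv_pow, ← map_pow, h1, mul_inv_eq_one, ← zpow_natCast, ← zpow_natCast,
      ← zpow_mul, ← zpow_mul, mul_comm]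
  have h3 := hc.mem_center_iff_form.1 h2 y
  rw [hc.form_mul_left, hc.form_zpow_left, hc.form_inv_left, hf] at h3
  rw [← h3]; module

end IsClassTwo

theorem IsPGroup.exists_pow_nsmul_form [Finite G] {p : ℕ} [Fact p.Prime] (hG : IsPGroup p G)
    (hc : IsClassTwo G) (hna : ¬ ∀ x y : G, hc.form x y = 0) :
    ∃ s, (∀ x y : G, p ^ (s + 1) • hc.form x y = 0) ∧ ∃ u v : G, p ^ s • hc.form u v ≠ 0 := by
  classical
  have hex : ∃ k, ∀ x y : G, p ^ k • hc.form x y = 0 := by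
    obtain ⟨k, hk⟩ := IsPGroup.iff_card.1 hG
    refine ⟨k, fun x y => hc.nsmul_form_eq_zero_iff.2 ?_⟩
    rw [← hk, pow_card_eq_one']
  obtain ⟨s, hs⟩ : ∃ s, Nat.find hex = s + 1 := Nat.exists_eq_succ_of_ne_zero fun h0 => by
    have := Nat.find_spec hex
    rw [h0] at this
    exact hna (by simpa using this)
  refine ⟨s, hs ▸ Nat.find_spec hex, ?_⟩
  have := Nat.find_min hex (m := s) (by omega)
  push Not at this
  exact this

theorem IsPEGroup.form_map_eq_zero_or_form_map_eq [Finite G] {p : ℕ} (hG : IsPEGroup p G)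
    (hgen : IsThreeGenerator G) (hc : IsClassTwo G) (f : G →* G) :
    (∀ x y, hc.form (f x) y = 0) ∨ ∀ x y, hc.form (f x) y = hc.form x y := by
  have : Fact p.Prime := ⟨hG.prime⟩
  by_cases hna : ∀ x y : G, hc.form x y = 0
  · exact Or.inl fun x y => hna _ _
  obtain ⟨s, hs, u, v, huv⟩ := hG.isPGroup.exists_pow_nsmul_form hc hna
  obtain ⟨a, b, c, habc⟩ := hG.exists_isAdapted hc hs huv hgen
  obtain ⟨l, hl⟩ := habc.exists_form_map_eq_zsmul hs hG.isEGroup f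
  have hord : addOrderOf (hc.form u v) = p ^ (s + 1) := addOrderOf_eq_prime_pow huv (hs u v)
  have hdvd : ((p : ℤ) ^ (s + 1)) ∣ l * (l - 1) := by
    have := addOrderOf_dvd_iff_zsmul_eq_zero.2
      (hc.zsmul_form_eq_zero_of_form_map hG.isEGroup hl u v)
    rw [hord] at this
    exact_mod_cast this
  have kill : ∀ {k : ℤ}, (p : ℤ) ^ (s + 1) ∣ k → ∀ x y, k • hc.form x y = 0 := by
    rintro _ ⟨k, rfl⟩ x y
    rw [mul_comm, mul_smul, ← Nat.cast_pow, natCast_zsmul, hs, smul_zero]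
  have hprime : Prime (p : ℤ) := Nat.prime_iff_prime_int.1 hG.prime
  -- Only one of l, l - 1 can be divisible by p, so the other factor absorbs all of p ^ (s + 1).
  by_cases hpl : (p : ℤ) ∣ l
  · have hpl' : ¬ (p : ℤ) ∣ l - 1 := fun h => hprime.not_dvd_one (by simpa using dvd_sub hpl h)
    left
    intro x y
    rw [hl, kill (hprime.pow_dvd_of_dvd_mul_right _ hpl' hdvd)]
  · right
    intro x y
    have := kill (hprime.pow_dvd_of_dvd_mul_left _ hpl hdvd) x y
    rw [hl, ← sub_eq_zero, ← this]; module

/-- For central a ^ i b ^ j c ^ k d, bracketing with a gives a relation forcing p to divide j and k;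
bracketing with b gives p ∣ i. -/
theorem IsPEGroup.exists_pow_eq_of_mem_center [Finite G] {p : ℕ} (hG : IsPEGroup p G)
    (hgen : IsThreeGenerator G) (hc : IsClassTwo G) (hna : ¬ ∀ x y : G, hc.form x y = 0) {z : G}
    (hz : z ∈ center G) : ∃ g : G, Abelianization.of z = Abelianization.of g ^ p := by
  have : Fact p.Prime := ⟨hG.prime⟩
  obtain ⟨s, hs, u, v, huv⟩ := hG.isPGroup.exists_pow_nsmul_form hc hna
  obtain ⟨a, b, c, habc⟩ := hG.exists_isAdapted hc hs huv hgen
  obtain ⟨i, j, k, d, hd, rfl⟩ := exists_zpow_mul_mem_commutator habc.closure_eq_top z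
  have hform : ∀ y, i • hc.form a y + j • hc.form b y + k • hc.form c y = 0 := fun y => by
    rw [← hc.form_zpow_mul_zpow_mul_zpow_mul a b c i j k hd]
    exact hc.mem_center_iff_form.1 hz y
  have h1 := habc.dvd_of_relation 0 k (-j) <| by
    have := hform a
    rw [hc.form_self, hc.form_swap b a] at this
    have := congrArg (p ^ s • ·) this
    simp only [smul_zero, zero_add] at this
    rw [← this]; module
  have h2 := habc.dvd_of_relation (-k) 0 i <| by
    have := hform b
    rw [hc.form_self, hc.form_swap c b] at this
    have := congrArg (p ^ s • ·) this
    simp only [smul_zero] at this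
    rw [← this]; module
  obtain ⟨i, rfl⟩ := h2.2
  obtain ⟨j, rfl⟩ := dvd_neg.1 h1.2
  obtain ⟨k, rfl⟩ := h1.1
  refine ⟨a ^ i * b ^ j * c ^ k, ?_⟩
  have hd' : Abelianization.of d = 1 := by
    rwa [← MonoidHom.mem_ker, Abelianization.ker_of]
  rw [map_mul, hd', mul_one, map_zpow_mul_zpow_mul_zpow, map_zpow_mul_zpow_mul_zpow, mul_pow,
    mul_pow]
  simp only [← zpow_natCast, ← zpow_mul, mul_comm]

/-- In a finite commutative `p`-group, a subgroup that together with the `p`-th powers generates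
the group is the whole group. -/
theorem IsPGroup.eq_top_of_forall_eq_mul_pow {Q : Type*} [CommGroup Q] [Finite Q] {p : ℕ}
    [Fact p.Prime] (hQ : IsPGroup p Q) {K : Subgroup Q}
    (h : ∀ x : Q, ∃ k ∈ K, ∃ g, x = k * g ^ p) : K = ⊤ := by
  have key : ∀ (N : ℕ) (x : Q), ∃ k ∈ K, ∃ g, x = k * g ^ p ^ N := by
    intro N
    induction N with
    | zero => exact fun x => ⟨1, one_mem K, x, by simp⟩
    | succ N ih =>
      intro x
      obtain ⟨k, hk, g, rfl⟩ := ih x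
      obtain ⟨k', hk', g', rfl⟩ := h g
      exact ⟨k * k' ^ p ^ N, mul_mem hk (pow_mem hk' _), g', by
        rw [mul_pow, mul_assoc, ← pow_mul, ← pow_succ']⟩
  obtain ⟨N, hN⟩ := IsPGroup.iff_card.1 hQ
  rw [eq_top_iff]
  intro x _
  obtain ⟨k, hk, g, rfl⟩ := key N x
  rwa [← hN, pow_card_eq_one', mul_one]

/-- A Frattini argument: f fixes commutators, so its range contains G', and x differs from f x by a
central element, which is a p-th power modulo G'. -/
theorem IsPEGroup.bijective_of_form_map_eq [Finite G] {p : ℕ} (hG : IsPEGroup p G)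
    (hgen : IsThreeGenerator G) (hc : IsClassTwo G) (hna : ¬ ∀ x y : G, hc.form x y = 0)
    {f : G →* G} (hf : ∀ x y, hc.form (f x) y = hc.form x y) : Function.Bijective f := by
  have : Fact p.Prime := ⟨hG.prime⟩
  have hQ : IsPGroup p (Abelianization G) :=
    hG.isPGroup.of_surjective _ (QuotientGroup.mk'_surjective _)
  have hder : commutator G ≤ f.range := by
    rw [commutator_eq_closure, closure_le]
    rintro _ ⟨x, y, rfl⟩
    refine ⟨⁅x, y⁆, ?_⟩
    rw [map_commutatorElement]
    have : hc.form (f x) (f y) = hc.form x y := by rw [hf, ← hc.form_map_left_eq hG.isEGroup, hf]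
    exact congrArg (fun z : Additive (center G) => (z.toMul : G)) this
  have htop : f.range.map Abelianization.of = ⊤ := by
    refine hQ.eq_top_of_forall_eq_mul_pow fun q => ?_
    obtain ⟨x, rfl⟩ := QuotientGroup.mk_surjective q
    have hz : (f x)⁻¹ * x ∈ center G := hc.mem_center_iff_form.2 fun y => by
      rw [hc.form_mul_left, hc.form_inv_left, hf, neg_add_cancel]
    obtain ⟨g, hg⟩ := hG.exists_pow_eq_of_mem_center hgen hc hna hz
    refine ⟨Abelianization.of (f x), mem_map_of_mem _ ⟨x, rfl⟩, Abelianization.of g, ?_⟩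
    rw [← hg, ← map_mul, mul_inv_cancel_left]
    rfl
  have hrange : f.range = ⊤ := by
    have := comap_map_eq_self (f := Abelianization.of) (H := f.range)
      (by rwa [Abelianization.ker_of])
    rw [← this, htop, comap_top]
  exact Finite.injective_iff_bijective.1
    (Finite.injective_iff_surjective.2 (MonoidHom.range_eq_top.1 hrange))

end Endomorphism

theorem lemma2p8 (p : ℕ) (G : Type*) [Group G] [Finite G]
    (hG : IsPEGroup p G) (hgen : IsThreeGenerator G) (α : G →* G) :
    (IsAutomorphism α → IsCentralAutomorphism α) ∧
      (¬ IsAutomorphism α → α.range ≤ Subgroup.center G) := by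
  have hc : IsClassTwo G := hG.commutator_mem_center hgen
  rcases hG.form_map_eq_zero_or_form_map_eq hgen hc α with h | h
  · refine ⟨fun hα => ⟨hα, fun g => ?_⟩, fun _ => ?_⟩
    -- Here the image is central, so surjectivity makes every element central.
    · obtain ⟨g', hg'⟩ := hα.2 (g⁻¹ * α g)
      rw [← hg']
      exact hc.mem_center_iff_form.2 (h g')
    · rintro _ ⟨x, rfl⟩
      exact hc.mem_center_iff_form.2 (h x)
  · refine ⟨fun hα => ⟨hα, fun g => hc.mem_center_iff_form.2 fun y => ?_⟩, fun hα => ?_⟩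
    · rw [hc.form_mul_left, hc.form_inv_left, h, neg_add_cancel]
    · by_cases hna : ∀ x y : G, hc.form x y = 0
      · rintro _ ⟨x, rfl⟩
        exact hc.mem_center_iff_form.2 (hna _)
      · exact absurd (hG.bijective_of_form_map_eq hgen hc hna h) hα
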